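/- For $\ell,\eta\in\mathbb R$ let $$\varphi_{\ell,\eta}(x)=\frac{1}{\Gamma(2\ell+2)}\,e^{-ix}\,{}_1F_1(\ell+1-i\eta,\,2\ell+2;\,2ix)=e^{-ix}\sum_{k=0}^\infty\frac{(\ell+1-i\eta)_k}{\Gamma(2\ell+2+k)}\,\frac{(2ix)^k}{k!}$$ be the modified regular Coulomb wave function, where $(a)_k=a(a+1)\cdots(a+k-1)$ is the Pochhammer symbol and $1/\Gamma$ is understood as $0$ at the poles of $\Gamma$; when $2\ell+2$ is a non-positive integer, $\varphi_{\ell,\eta}$ is thus defined by the series, that is, by the limit in $\ell$ of the first expression. **Theorem.** Let $\ell\le -3/2$ and $\eta\neq 0$. Then $\varphi_{\ell,\eta}$ has countably infinitely many zeros on $\mathbb R$. All its real zeros other than $x=0$ are simple, and $x=0$ is a zero only if $2\ell\in\mathbb Z$. Moreover, the positive zeros of $\varphi_{\ell,\eta}$ and of $\varphi_{\ell+1,\eta}$ form infinite increasing sequences $\rho_{\ell,\eta,1}<\rho_{\ell,\eta,2}<\cdots$ and $\rho_{\ell+1,\eta,1}<\rho_{\ell+1,\eta,2}<\cdots$, and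 these interlace according to the pattern $$0<\rho_{\ell+1,\eta,1}<\rho_{\ell,\eta,1}<\rho_{\ell+1,\eta,2}<\rho_{\ell,\eta,2}<\cdots .$$ Likewise, the negative zeros of $\varphi_{\ell,\eta}$ and of $\varphi_{\ell+1,\eta}$ form infinite decreasing sequences $\nu_{\ell,\eta,1}>\nu_{\ell,\eta,2}>\cdots$ and $\nu_{\ell+1,\eta,1}>\nu_{\ell+1,\eta,2}>\cdots$, with $$0>\nu_{\ell+1,\eta,1}>\nu_{\ell,\eta,1}>\nu_{\ell+1,\eta,2}>\nu_{\ell,\eta,2}>\cdots .$$ -/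

import Mathlib

open Filter Topology

/-- Kummer's confluent hypergeometric function `₁F₁(a, b; z) = ∑ (a)_k / (b)_k * z ^ k / k!`,
for `b` not a non-positive integer. -/
noncomputable def kummerF (a b z : ℂ) : ℂ :=
  ∑' k : ℕ, (ascPochhammer ℂ k).eval a / (ascPochhammer ℂ k).eval b * z ^ k / (k.factorial : ℂ)

/-- `φ_{ℓ,η}(z) = e^{-iz} ₁F₁(ℓ + 1 - iη, 2ℓ + 2; 2iz)`, for `2ℓ + 2` not a non-positive
integer. -/
noncomputable def coulombPhi (ℓ η : ℝ) (z : ℂ) : ℂ :=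
  Complex.exp (-Complex.I * z) *
    kummerF ((ℓ : ℂ) + 1 - Complex.I * η) (2 * (ℓ : ℂ) + 2) (2 * Complex.I * z)

/-- The regularized confluent hypergeometric function `₁F₁(a, b; z) / Γ(b)`, as the series
`∑ (a)_k / Γ(b + k) * z ^ k / k!`, which makes sense for every `b`: the reciprocal `1 / Γ` is entire,
and in Mathlib `(Complex.Gamma s)⁻¹` is `0` at the poles of `Γ`, as it should be. -/
noncomputable def kummerReg (a b z : ℂ) : ℂ :=
  ∑' k : ℕ, (ascPochhammer ℂ k).eval a * (Complex.Gamma (b + k))⁻¹ * z ^ k / (k.factorial : ℂ)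

/-- The modified regular Coulomb wave function `φ_{ℓ,η} / Γ(2ℓ + 2)`, for all real `ℓ`. When
`2ℓ + 2` is a non-positive integer it is the limit of the quotient in `ℓ`; see
`modCoulomb_eq_div` and `tendsto_div_modCoulomb`. -/
noncomputable def modCoulomb (ℓ η : ℝ) (z : ℂ) : ℂ :=
  Complex.exp (-Complex.I * z) *
    kummerReg ((ℓ : ℂ) + 1 - Complex.I * η) (2 * (ℓ : ℂ) + 2) (2 * Complex.I * z)

theorem gamma_add_nat_eq (b : ℂ) (hb : ∀ n : ℕ, b ≠ -n) (k : ℕ) :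
    Complex.Gamma (b + k) = (ascPochhammer ℂ k).eval b * Complex.Gamma b := by
  induction k with
  | zero => simp
  | succ k ih =>
    have h : b + k ≠ 0 := fun h => hb k (eq_neg_of_add_eq_zero_left h)
    rw [Nat.cast_succ, ← add_assoc, Complex.Gamma_add_one _ h, ih, ascPochhammer_succ_eval]
    ring

/-- Away from the poles, `modCoulomb` is the quotient `φ_{ℓ,η} / Γ(2ℓ + 2)`. -/
theorem modCoulomb_eq_div (ℓ η : ℝ) (z : ℂ) (h : ∀ n : ℕ, 2 * ℓ + 2 ≠ -(n : ℝ)) :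
    modCoulomb ℓ η z = coulombPhi ℓ η z / Complex.Gamma (2 * (ℓ : ℂ) + 2) := by
  have h' : ∀ n : ℕ, 2 * (ℓ : ℂ) + 2 ≠ -n := fun n hn => h n (by exact_mod_cast hn)
  unfold modCoulomb coulombPhi kummerReg kummerF
  rw [mul_div_assoc, ← tsum_div_const]
  congr 2
  funext k
  rw [gamma_add_nat_eq _ h', mul_inv]
  ring

set_option maxHeartbeats 1000000 in
theorem continuous_modCoulomb_left (η : ℝ) (z : ℂ) : Continuous fun ℓ : ℝ => modCoulomb ℓ η z := by
  unfold modCoulomb kummerReg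
  refine continuous_const.mul ?_
  set w : ℂ := 2 * Complex.I * z with hw
  set f : ℕ → ℝ → ℂ := fun k ℓ => (ascPochhammer ℂ k).eval ((ℓ : ℂ) + 1 - Complex.I * η) *
    (Complex.Gamma (2 * (ℓ : ℂ) + 2 + k))⁻¹ * w ^ k / (k.factorial : ℂ) with hf
  have hfc : ∀ k, Continuous (f k) := by
    intro k
    have h1 : Continuous fun s : ℂ => (Complex.Gamma s)⁻¹ :=
      Complex.differentiable_one_div_Gamma.continuous
    have h2 : Continuous fun ℓ : ℝ => (Complex.Gamma (2 * (ℓ : ℂ) + 2 + k))⁻¹ :=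
      h1.comp (by fun_prop)
    have h3 : Continuous fun ℓ : ℝ =>
        (ascPochhammer ℂ k).eval ((ℓ : ℂ) + 1 - Complex.I * η) :=
      (ascPochhammer ℂ k).continuous.comp (by fun_prop)
    exact ((h3.mul h2).mul continuous_const).div_const _
  rw [continuous_iff_continuousAt]
  intro ℓ₀
  obtain ⟨N, hN⟩ := exists_nat_ge (2 * (|ℓ₀| + 1))
  set R : ℝ := |ℓ₀| + 1 with hR
  have hR0 : 0 < R := by positivity
  set c : ℝ := R + 1 + |η| with hc
  have hc0 : 0 < c := by positivity
  set A : ℕ → ℝ := fun k => ∏ j ∈ Finset.range k, (c + j) with hA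
  have hA0 : ∀ k, 0 < A k := fun k => Finset.prod_pos fun j _ => by positivity
  set u : ℕ → ℝ := fun k => A (k + N) * ((k + 1).factorial : ℝ)⁻¹ * (‖w‖ + 1) ^ (k + N) /
    ((k + N).factorial : ℝ) with hu
  have hu0 : ∀ k, 0 < u k := by
    intro k
    have := hA0 (k + N)
    positivity
  have husum : Summable u := by
    have hr : ∀ k : ℕ, ‖u (k + 1)‖ / ‖u k‖ =
        (c + (k + N : ℕ)) / ((k + N : ℕ) + 1) * ((‖w‖ + 1) / (k + 2)) := by
      intro k
      rw [Real.norm_of_nonneg (hu0 _).le, Real.norm_of_nonneg (hu0 _).le]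
      have h1 : A (k + 1 + N) = A (k + N) * (c + (k + N : ℕ)) := by
        rw [show k + 1 + N = (k + N) + 1 by ring, hA]
        exact Finset.prod_range_succ _ _
      have h2 := (hA0 (k + N)).ne'
      simp only [hu, h1]
      rw [show k + 1 + N = (k + N) + 1 by ring, Nat.factorial_succ (k + N),
        Nat.factorial_succ (k + 1)]
      push_cast
      have h3 : ((k + N).factorial : ℝ) ≠ 0 := by positivity
      have h4 : ((k + 1).factorial : ℝ) ≠ 0 := by positivity
      have h5 : (‖w‖ + 1) ≠ 0 := by positivity
      field_simp
      ring
    refine summable_of_ratio_test_tendsto_lt_one (l := 0) zero_lt_one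
      (Eventually.of_forall fun k => (hu0 k).ne') ?_
    simp_rw [hr]
    refine squeeze_zero (fun k => by positivity)
      (g := fun k : ℕ => (c + 1) * ((‖w‖ + 1) / (k + 2))) ?_ ?_
    · intro k
      gcongr
      rw [div_le_iff₀ (by positivity)]
      have : (0 : ℝ) ≤ ((k + N : ℕ) : ℝ) := by positivity
      nlinarith
    · rw [← mul_zero (c + 1)]
      refine Tendsto.const_mul _ (Tendsto.div_atTop tendsto_const_nhds ?_)
      exact tendsto_atTop_add_const_right _ _ tendsto_natCast_atTop_atTop
  have hbound : ∀ k : ℕ, ∀ ℓ ∈ Metric.ball ℓ₀ 1, ‖f (k + N) ℓ‖ ≤ u k := by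
    intro k ℓ hℓ
    have hℓR : |ℓ| ≤ R := by
      rw [Metric.mem_ball, Real.dist_eq] at hℓ
      have := abs_sub_abs_le_abs_sub ℓ ℓ₀
      linarith
    have hP : ∀ m : ℕ, ‖(ascPochhammer ℂ m).eval ((ℓ : ℂ) + 1 - Complex.I * η)‖ ≤ A m := by
      intro m
      have hstep : ∀ j : ℕ, ‖(ℓ : ℂ) + 1 - Complex.I * η + j‖ ≤ c + j := by
        intro j
        have t1 := norm_add_le ((ℓ : ℂ) + 1 - Complex.I * η) (j : ℂ)
        have t2 := norm_sub_le ((ℓ : ℂ) + 1) (Complex.I * η)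
        have t3 := norm_add_le (ℓ : ℂ) 1
        simp only [Complex.norm_real, Real.norm_eq_abs, norm_one, norm_mul, Complex.norm_I,
          one_mul, Complex.norm_natCast] at t1 t2 t3
        linarith
      induction m with
      | zero => simp [hA]
      | succ m ih =>
        have e : A (m + 1) = A m * (c + m) := Finset.prod_range_succ _ _
        rw [ascPochhammer_succ_eval, norm_mul, e]
        exact mul_le_mul ih (hstep m) (norm_nonneg _) (hA0 m).le
    have hG : ‖(Complex.Gamma (2 * (ℓ : ℂ) + 2 + (k + N : ℕ)))⁻¹‖ ≤
        ((k + 1).factorial : ℝ)⁻¹ := by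
      have e : (2 * (ℓ : ℂ) + 2 + (k + N : ℕ)) = ((2 * ℓ + 2 + (k + N : ℕ) : ℝ) : ℂ) := by
        push_cast; ring
      have hx : (k : ℝ) + 2 ≤ 2 * ℓ + 2 + (k + N : ℕ) := by
        have := neg_abs_le ℓ
        push_cast
        linarith
      have hk : (0 : ℝ) ≤ k := k.cast_nonneg
      have hg : ((k + 1).factorial : ℝ) ≤ Real.Gamma (2 * ℓ + 2 + (k + N : ℕ)) := by
        rw [← Real.Gamma_nat_eq_factorial]
        refine Real.Gamma_strictMonoOn_Ici.monotoneOn ?_ ?_ ?_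
        · simp only [Set.mem_Ici]; push_cast; linarith
        · simp only [Set.mem_Ici]; linarith
        · push_cast at hx ⊢; linarith
      have hpos : (0 : ℝ) < ((k + 1).factorial : ℝ) := by positivity
      rw [e, Complex.Gamma_ofReal, norm_inv, Complex.norm_real, Real.norm_eq_abs]
      exact inv_anti₀ hpos (hg.trans (le_abs_self _))
    simp only [hf, hu, norm_div, norm_mul, norm_pow, Complex.norm_natCast]
    have := (hA0 (k + N)).le
    gcongr
    · exact hP _
    · linarith
  have htail : ContinuousOn (fun ℓ => ∑' k, f (k + N) ℓ) (Metric.ball ℓ₀ 1) :=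
    continuousOn_tsum (fun k => (hfc (k + N)).continuousOn) husum hbound
  have hmem : Metric.ball ℓ₀ 1 ∈ 𝓝 ℓ₀ := Metric.ball_mem_nhds _ one_pos
  have hsum : ContinuousAt
      (fun ℓ => ∑ k ∈ Finset.range N, f k ℓ + ∑' k, f (k + N) ℓ) ℓ₀ :=
    (continuous_finsetSum _ fun k _ => hfc k).continuousAt.add (htail.continuousAt hmem)
  refine hsum.congr ?_
  filter_upwards [hmem] with ℓ hℓ
  have hs : Summable fun k => f (k + N) ℓ :=
    Summable.of_norm_bounded husum fun k => hbound k ℓ hℓ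
  exact ((summable_nat_add_iff N).mp hs).sum_add_tsum_nat_add N

/-- At every `ℓ₀`, in particular where `2ℓ₀ + 2` is a pole of `Γ`, the value of `modCoulomb` is the
limit of the quotients `φ_{ℓ,η} / Γ(2ℓ + 2)` as `ℓ → ℓ₀`. -/
theorem tendsto_div_modCoulomb (ℓ₀ η : ℝ) (z : ℂ) :
    Tendsto (fun ℓ : ℝ => coulombPhi ℓ η z / Complex.Gamma (2 * (ℓ : ℂ) + 2)) (𝓝[≠] ℓ₀)
      (𝓝 (modCoulomb ℓ₀ η z)) := by
  refine Tendsto.congr' ?_ ((continuous_modCoulomb_left η z).tendsto ℓ₀ |>.mono_left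
    nhdsWithin_le_nhds)
  have hball : Metric.ball ℓ₀ (1 / 4) ∈ 𝓝[≠] ℓ₀ :=
    nhdsWithin_le_nhds (Metric.ball_mem_nhds _ (by norm_num))
  by_cases h₀ : ∃ n : ℕ, 2 * ℓ₀ + 2 = -(n : ℝ)
  · obtain ⟨m, hm⟩ := h₀
    filter_upwards [hball, self_mem_nhdsWithin] with ℓ hℓ hne
    refine modCoulomb_eq_div ℓ η z fun n hn => hne ?_
    rw [Metric.mem_ball, Real.dist_eq, abs_lt] at hℓ
    have h1 : (n : ℝ) < m + 1 := by linarith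
    have h2 : (m : ℝ) < n + 1 := by linarith
    have h3 : n < m + 1 := by exact_mod_cast h1
    have h4 : m < n + 1 := by exact_mod_cast h2
    have h5 : n = m := by omega
    rw [Set.mem_singleton_iff]
    subst h5
    linarith
  · push Not at h₀
    have hG : ContinuousAt (fun ℓ : ℝ => (Complex.Gamma (2 * (ℓ : ℂ) + 2))⁻¹) ℓ₀ :=
      (Complex.differentiable_one_div_Gamma.continuous.comp
        (f := fun ℓ : ℝ => 2 * (ℓ : ℂ) + 2) (by fun_prop)).continuousAt
    have hne : (Complex.Gamma (2 * (ℓ₀ : ℂ) + 2))⁻¹ ≠ 0 :=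
      inv_ne_zero (Complex.Gamma_ne_zero fun n hn => h₀ n (by exact_mod_cast hn))
    filter_upwards [nhdsWithin_le_nhds (hG.eventually_ne hne)] with ℓ hℓ
    refine modCoulomb_eq_div ℓ η z fun n hn => hℓ ?_
    have e : 2 * (ℓ : ℂ) + 2 = -n := by exact_mod_cast hn
    rw [e, Complex.Gamma_neg_nat_eq_zero, inv_zero]

/-- `ρ 0 < ρ 1 < ⋯` is an infinite sequence listing all positive zeros of `f` in increasing
order. -/
def IsPositiveZeroSeq (f : ℂ → ℂ) (ρ : ℕ → ℝ) : Prop :=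
  StrictMono ρ ∧ Set.range ρ = {x : ℝ | 0 < x ∧ f x = 0}

/-- `ρ 0 > ρ 1 > ⋯` is an infinite sequence listing all negative zeros of `f` in decreasing
order. -/
def IsNegativeZeroSeq (f : ℂ → ℂ) (ρ : ℕ → ℝ) : Prop :=
  StrictAnti ρ ∧ Set.range ρ = {x : ℝ | x < 0 ∧ f x = 0}

/-!
Write `u = φ_{ℓ,η}` and `v = φ_{ℓ+1,η}`. Kummer's transformation shows that both are real on the real
line and that `φ_{ℓ,η}(-x) = φ_{ℓ,-η}(x)`, so only the positive zeros need attention. The contiguous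
relations of the regularized series, which hold for all parameters, give the linear system
`u' = α u + d x v`, `x v' = k u - (2ℓ + 3 + α x) v` with `α = η / (ℓ + 1)`,
`d = -2 ((ℓ + 1)² + η²) / (ℓ + 1)` and `k = 1 / (2ℓ + 2)`, together with
`u(0) = (2ℓ + 2)(2ℓ + 3) v(0)`. Everything follows from this system; integer values of `2ℓ` need no
separate treatment.

* Zeros are isolated because `u` is entire and not identically zero, and away from the origin they
  are simple because `u` and `v` cannot vanish together there
  (`analyticOrderAt_modCoulomb_eq_one`).
* Sturm comparison for `x ^ (ℓ + 1) u`, a solution of the Coulomb equation, shows that there are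
  infinitely many of them (`exists_gt_coulombReal_eq_zero`).
* Rolle's theorem for `e^{-αx} u` and for `x ^ (2ℓ + 3) e^{αx} v` puts a zero of each function between
  two zeros of the other (`exists_coulombReal_add_one_eq_zero_between`,
  `exists_coulombReal_eq_zero_between`).
* The order in which the two sequences start is where `ℓ ≤ -3/2` enters: it makes `d` positive and
  `(2ℓ + 2)(2ℓ + 3)` nonnegative, so `u` cannot vanish before `v` does
  (`exists_coulombReal_add_one_eq_zero_lt`).
-/

/-! ### The regularized Kummer series -/

theorem ascPochhammer_succ_eval_left (a : ℂ) (k : ℕ) :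
    (ascPochhammer ℂ (k + 1)).eval a = a * (ascPochhammer ℂ k).eval (a + 1) := by
  simp [ascPochhammer_succ_left]

theorem summable_norm_kummerReg (a b z : ℂ) :
    Summable fun k : ℕ =>
      ‖(ascPochhammer ℂ k).eval a * (Complex.Gamma (b + k))⁻¹ * z ^ k / (k.factorial : ℂ)‖ := by
  refine summable_of_ratio_norm_eventually_le (r := 1 / 2) (by norm_num) ?_
  filter_upwards [eventually_ge_atTop (⌈2 * ‖b‖⌉₊ + ⌈‖a‖⌉₊ + ⌈8 * ‖z‖⌉₊ + 1)] with k hk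
  have hkR : 2 * ‖b‖ + ‖a‖ + 8 * ‖z‖ + 1 ≤ k := by
    have h1 := Nat.le_ceil (2 * ‖b‖)
    have h2 := Nat.le_ceil ‖a‖
    have h3 := Nat.le_ceil (8 * ‖z‖)
    have h4 : ((⌈2 * ‖b‖⌉₊ + ⌈‖a‖⌉₊ + ⌈8 * ‖z‖⌉₊ + 1 : ℕ) : ℝ) ≤ k := by exact_mod_cast hk
    push_cast at h4
    linarith
  have hb0 := norm_nonneg b
  have ha0 := norm_nonneg a
  have hz0 := norm_nonneg z
  have hb : (k : ℝ) / 2 ≤ ‖b + k‖ := by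
    have := norm_sub_norm_le (k : ℂ) (-b)
    rw [norm_neg, Complex.norm_natCast, sub_neg_eq_add, add_comm (k : ℂ)] at this
    linarith
  have ha : ‖a + k‖ ≤ 2 * k := by
    have := norm_add_le a (k : ℂ)
    rw [Complex.norm_natCast] at this
    linarith
  have hG := Complex.one_div_Gamma_eq_self_mul_one_div_Gamma_add_one (b + k)
  have hb' : b + k ≠ 0 := norm_pos_iff.mp (by linarith)
  have hstep : (ascPochhammer ℂ (k + 1)).eval a * (Complex.Gamma (b + (k + 1 : ℕ)))⁻¹ *
      z ^ (k + 1) / ((k + 1).factorial : ℂ) = ((a + k) * z / ((b + k) * (k + 1))) *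
      ((ascPochhammer ℂ k).eval a * (Complex.Gamma (b + k))⁻¹ * z ^ k / (k.factorial : ℂ)) := by
    have h1 : ((k : ℂ) + 1) ≠ 0 := by exact_mod_cast k.succ_ne_zero
    have h2 : (k.factorial : ℂ) ≠ 0 := by exact_mod_cast k.factorial_ne_zero
    rw [hG, ascPochhammer_succ_eval, Nat.factorial_succ]
    push_cast
    rw [← add_assoc]
    field_simp
    ring
  rw [hstep, norm_norm, norm_norm, norm_mul]
  refine mul_le_mul_of_nonneg_right ?_ (norm_nonneg _)
  have hk1 : ‖(k : ℂ) + 1‖ = k + 1 := by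
    rw [show (k : ℂ) + 1 = ((k + 1 : ℕ) : ℂ) by push_cast; rfl, Complex.norm_natCast]
    push_cast; rfl
  rw [norm_div, norm_mul, norm_mul, hk1, div_le_iff₀ (by nlinarith)]
  calc ‖a + k‖ * ‖z‖ ≤ 2 * k * (k / 8) := by gcongr; linarith
    _ = 1 / 2 * (k / 2 * k) := by ring
    _ ≤ 1 / 2 * (‖b + k‖ * (k + 1)) := by gcongr; linarith

theorem hasSum_kummerReg (a b z : ℂ) :
    HasSum (fun k : ℕ => (ascPochhammer ℂ k).eval a * (Complex.Gamma (b + k))⁻¹ * z ^ k /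
      (k.factorial : ℂ)) (kummerReg a b z) :=
  (summable_norm_kummerReg a b z).of_norm.hasSum

/-- The series of `z K(a, b; z)` in powers `z ^ k / k!`. The truncated `k - 1` at `k = 0` is harmless
because of the factor `k`. -/
theorem hasSum_mul_kummerReg (a b z : ℂ) :
    HasSum (fun k : ℕ => k * ((ascPochhammer ℂ (k - 1)).eval a *
      (Complex.Gamma (b + (k - 1 : ℕ)))⁻¹) * z ^ k / (k.factorial : ℂ)) (z * kummerReg a b z) := by
  rw [← hasSum_nat_add_iff' 1]
  simp only [Finset.range_one, Finset.sum_singleton, Nat.cast_zero, zero_mul, zero_div, sub_zero,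
    Nat.add_sub_cancel]
  refine ((hasSum_kummerReg a b z).mul_left z).congr_fun fun k => ?_
  have h1 : ((k : ℂ) + 1) ≠ 0 := by exact_mod_cast k.succ_ne_zero
  have h2 : (k.factorial : ℂ) ≠ 0 := by exact_mod_cast k.factorial_ne_zero
  rw [Nat.factorial_succ]
  push_cast
  field_simp
  ring

@[simp]
theorem kummerReg_zero (a b : ℂ) : kummerReg a b 0 = (Complex.Gamma b)⁻¹ := by
  unfold kummerReg
  rw [tsum_eq_single 0 fun k hk => by simp [hk]]
  simp

theorem hasDerivAt_kummerReg (a b z : ℂ) :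
    HasDerivAt (kummerReg a b) (a * kummerReg (a + 1) (b + 1) z) z := by
  set c : ℕ → ℂ := fun k => (ascPochhammer ℂ k).eval a * (Complex.Gamma (b + k))⁻¹ with hc
  have hc1 : ∀ k, c (k + 1) = a * ((ascPochhammer ℂ k).eval (a + 1) *
      (Complex.Gamma (b + 1 + k))⁻¹) := by
    intro k
    simp only [hc, ascPochhammer_succ_eval_left]
    push_cast
    rw [show b + (k + 1 : ℂ) = b + 1 + k by ring]
    ring
  set R : ℝ := ‖z‖ + 1 with hR
  have hR0 : 0 < R := by positivity
  have hz : z ∈ Metric.ball (0 : ℂ) R := by simp [hR]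
  set g' : ℕ → ℂ → ℂ := fun k w => c k * (k * w ^ (k - 1)) / (k.factorial : ℂ) with hg'
  have hg1 : ∀ k w, g' (k + 1) w = a * ((ascPochhammer ℂ k).eval (a + 1) *
      (Complex.Gamma (b + 1 + k))⁻¹ * w ^ k / (k.factorial : ℂ)) := by
    intro k w
    have h1 : ((k : ℂ) + 1) ≠ 0 := by exact_mod_cast k.succ_ne_zero
    have h2 : (k.factorial : ℂ) ≠ 0 := by exact_mod_cast k.factorial_ne_zero
    simp only [hg', hc1, Nat.factorial_succ, Nat.add_sub_cancel]
    push_cast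
    field_simp
  have hg0 : ∀ w, g' 0 w = 0 := fun w => by simp [hg']
  have hu : Summable fun k => ‖g' k (R : ℂ)‖ := by
    rw [← summable_nat_add_iff 1]
    simp only [hg1, norm_mul a]
    exact (summable_norm_kummerReg (a + 1) (b + 1) R).mul_left ‖a‖
  have hsum : HasSum (fun k => g' k z) (a * kummerReg (a + 1) (b + 1) z) := by
    rw [← hasSum_nat_add_iff' 1]
    simp only [hg1, hg0, Finset.range_one, Finset.sum_singleton, sub_zero]
    exact (hasSum_kummerReg _ _ _).mul_left a
  rw [← hsum.tsum_eq]
  refine hasDerivAt_tsum_of_isPreconnected (t := Metric.ball 0 R) (y₀ := z) hu Metric.isOpen_ball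
    (convex_ball _ _).isPreconnected (fun k w _ => ?_) (fun k w hw => ?_) hz
    (hasSum_kummerReg a b z).summable hz
  · exact ((hasDerivAt_pow k w).const_mul (c k)).div_const _
  · rw [mem_ball_zero_iff] at hw
    simp only [hg', norm_div, norm_mul, norm_pow, Complex.norm_real, Real.norm_of_nonneg hR0.le]
    gcongr

/-! ### Contiguous relations -/

/-- Termwise this is `b (a + k) = a (b + k) + k (b - a)`. It is what expresses the derivative of
`φ_{ℓ,η}` as a combination of `φ_{ℓ,η}` and `φ_{ℓ+1,η}`. -/
theorem mul_kummerReg_add_one (a b z : ℂ) :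
    b * kummerReg (a + 1) (b + 1) z =
      kummerReg a b z + (b - a) * (z * kummerReg (a + 1) (b + 2) z) := by
  refine ((hasSum_kummerReg (a + 1) (b + 1) z).mul_left b).unique ?_
  refine ((hasSum_kummerReg a b z).add
    ((hasSum_mul_kummerReg (a + 1) (b + 2) z).mul_left (b - a))).congr_fun fun k => ?_
  rcases k with _ | k
  · simp [Complex.one_div_Gamma_eq_self_mul_one_div_Gamma_add_one b]
  · have hG := Complex.one_div_Gamma_eq_self_mul_one_div_Gamma_add_one (b + (k + 1))
    rw [ascPochhammer_succ_eval_left a, ascPochhammer_succ_eval, Nat.add_sub_cancel]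
    push_cast
    rw [hG, show b + 1 + (k + 1 : ℂ) = b + (k + 1) + 1 by ring,
      show b + 2 + (k : ℂ) = b + (k + 1) + 1 by ring]
    ring

/-- The relation `(z d/dz + b - 1) K(a, b; z) = K(a, b - 1; z)` for `K = ₁F₁ / Γ(b)`, with the
derivative written out. -/
theorem mul_mul_kummerReg_add_one (a b z : ℂ) :
    z * (a * kummerReg (a + 1) (b + 1) z) = kummerReg a (b - 1) z - (b - 1) * kummerReg a b z := by
  rw [eq_sub_iff_add_eq]
  have h := (((hasSum_mul_kummerReg (a + 1) (b + 1) z).mul_left a).add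
    ((hasSum_kummerReg a b z).mul_left (b - 1)))
  rw [mul_left_comm]
  refine h.unique ((hasSum_kummerReg a (b - 1) z).congr_fun fun k => ?_)
  have hG := Complex.one_div_Gamma_eq_self_mul_one_div_Gamma_add_one (b - 1 + k)
  rw [hG, show b - 1 + (k : ℂ) + 1 = b + k by ring]
  rcases k with _ | k
  · simp
  · rw [ascPochhammer_succ_eval_left a, Nat.add_sub_cancel]
    push_cast
    rw [show b + 1 + (k : ℂ) = b + (k + 1) by ring]
    ring

/-! ### Kummer's transformation -/

/-- A form of the Chu–Vandermonde identity, without denominators. -/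
theorem sum_antidiagonal_choose_ascPochhammer (n : ℕ) (a b : ℂ) :
    ∑ p ∈ Finset.HasAntidiagonal.antidiagonal n, (n.choose p.1 : ℂ) *
      ((-1) ^ p.1 * (ascPochhammer ℂ p.1).eval a *
      (ascPochhammer ℂ p.2).eval (b + p.1)) = (ascPochhammer ℂ n).eval (b - a) := by
  induction n generalizing a b with
  | zero => simp
  | succ n ih =>
    have h := Finset.sum_antidiagonal_choose_succ_mul
      (fun i j : ℕ => (-1 : ℂ) ^ i * (ascPochhammer ℂ i).eval a *
        (ascPochhammer ℂ j).eval (b + i)) n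
    rw [h]
    have h1 : ∑ p ∈ Finset.HasAntidiagonal.antidiagonal n, (n.choose p.1 : ℂ) * ((-1) ^ p.1 *
        (ascPochhammer ℂ p.1).eval a * (ascPochhammer ℂ (p.2 + 1)).eval (b + p.1)) =
        (b + n) * (ascPochhammer ℂ n).eval (b - a) := by
      rw [← ih, Finset.mul_sum]
      refine Finset.sum_congr rfl fun p hp => ?_
      rw [Finset.HasAntidiagonal.mem_antidiagonal] at hp
      rw [ascPochhammer_succ_eval, ← hp]
      push_cast
      ring
    have h2 : ∑ p ∈ Finset.HasAntidiagonal.antidiagonal n, (n.choose p.2 : ℂ) * ((-1) ^ (p.1 + 1) *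
        (ascPochhammer ℂ (p.1 + 1)).eval a *
          (ascPochhammer ℂ p.2).eval (b + (p.1 + 1 : ℕ))) =
        -a * (ascPochhammer ℂ n).eval (b - a) := by
      have := ih (a + 1) (b + 1)
      rw [add_sub_add_right_eq_sub] at this
      rw [← this, Finset.mul_sum]
      refine Finset.sum_congr rfl fun p hp => ?_
      rw [Finset.HasAntidiagonal.mem_antidiagonal] at hp
      have hch : n.choose p.2 = n.choose p.1 := by
        rw [← hp, Nat.choose_symm_add]
      rw [ascPochhammer_succ_eval_left, hch]
      push_cast
      rw [show b + ((p.1 : ℂ) + 1) = b + 1 + p.1 by ring]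
      ring
    rw [h1, h2, ascPochhammer_succ_eval]
    ring

theorem inv_Gamma_add_eq (b : ℂ) (n : ℕ) :
    (Complex.Gamma b)⁻¹ = (ascPochhammer ℂ n).eval b * (Complex.Gamma (b + n))⁻¹ := by
  induction n with
  | zero => simp
  | succ n ih =>
    rw [ih, Complex.one_div_Gamma_eq_self_mul_one_div_Gamma_add_one (b + n),
      ascPochhammer_succ_eval]
    push_cast
    rw [add_assoc, mul_assoc]

/-- Kummer's transformation `e^{-z} ₁F₁(a, b; z) = ₁F₁(b - a, b; -z)` in its regularized form. -/
theorem exp_neg_mul_kummerReg (a b z : ℂ) :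
    Complex.exp (-z) * kummerReg a b z = kummerReg (b - a) b (-z) := by
  have he : Summable fun k : ℕ => ‖(-z) ^ k / (k.factorial : ℂ)‖ := by
    simpa using Real.summable_pow_div_factorial ‖z‖
  have hexp : Complex.exp (-z) = ∑' k : ℕ, (-z) ^ k / (k.factorial : ℂ) := by
    rw [Complex.exp_eq_exp_ℂ, NormedSpace.exp_eq_tsum_div]
  rw [mul_comm, hexp]
  unfold kummerReg
  rw [tsum_mul_tsum_eq_tsum_sum_antidiagonal_of_summable_norm (summable_norm_kummerReg a b z) he]
  congr 1
  funext n
  rw [← sum_antidiagonal_choose_ascPochhammer n a b, Finset.sum_mul, Finset.sum_mul,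
    Finset.sum_div]
  refine Finset.sum_congr rfl fun p hp => ?_
  rw [Finset.HasAntidiagonal.mem_antidiagonal] at hp
  have h1 : (p.1.factorial : ℂ) ≠ 0 := by exact_mod_cast p.1.factorial_ne_zero
  have h2 : (p.2.factorial : ℂ) ≠ 0 := by exact_mod_cast p.2.factorial_ne_zero
  have h3 : (n.factorial : ℂ) ≠ 0 := by exact_mod_cast n.factorial_ne_zero
  have hch : (n.choose p.1 : ℂ) * p.1.factorial * p.2.factorial = n.factorial := by
    rw [← hp]
    have := Nat.add_choose_mul_factorial_mul_factorial p.1 p.2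
    rw [← Nat.choose_symm_add] at this
    exact_mod_cast this
  have hs : (-1 : ℂ) ^ p.1 * (-1) ^ p.1 = 1 := by
    rw [← mul_pow]; simp
  have hc0 : (n.choose p.1 : ℂ) ≠ 0 := by
    intro h0
    rw [h0, zero_mul, zero_mul] at hch
    exact h3 hch.symm
  have hz : (-z) ^ n = (-1) ^ p.1 * z ^ p.1 * (-z) ^ p.2 := by
    rw [← hp, pow_add, neg_pow z p.1]
  rw [inv_Gamma_add_eq (b + p.1) p.2, add_assoc, ← Nat.cast_add, hp, ← hch, hz]
  generalize (Complex.Gamma (b + n))⁻¹ = G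
  field_simp
  linear_combination (-(Polynomial.eval a (ascPochhammer ℂ p.1)) * z ^ p.1 * (-z) ^ p.2 * G *
    (Polynomial.eval (b + p.1) (ascPochhammer ℂ p.2))) * hs

theorem conj_kummerReg (a b z : ℂ) :
    (starRingEnd ℂ) (kummerReg a b z) =
      kummerReg ((starRingEnd ℂ) a) ((starRingEnd ℂ) b) ((starRingEnd ℂ) z) := by
  have hp : ∀ k : ℕ, (starRingEnd ℂ) ((ascPochhammer ℂ k).eval a) =
      (ascPochhammer ℂ k).eval ((starRingEnd ℂ) a) := by
    intro k
    induction k with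
    | zero => simp
    | succ k ih => simp [ascPochhammer_succ_eval, ih]
  unfold kummerReg
  rw [Complex.conj_tsum]
  congr 1
  funext k
  simp [hp, ← Complex.Gamma_conj]

/-! ### Nontriviality -/

/-- Repeated differentiation multiplies `₁F₁(a, b; ·) / Γ(b)` by a nonzero constant and raises both
parameters, until the value at the origin, a reciprocal Gamma value, is visibly nonzero. -/
theorem exists_kummerReg_ne_zero (a b : ℂ) (ha : ∀ n : ℕ, a ≠ -n) : ∃ z, kummerReg a b z ≠ 0 := by
  by_contra! h
  have hall : ∀ n : ℕ, ∀ z, kummerReg (a + n) (b + n) z = 0 := by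
    intro n
    induction n with
    | zero => simpa using h
    | succ n ih =>
      intro z
      have hd := hasDerivAt_kummerReg (a + n) (b + n) z
      rw [show kummerReg (a + n) (b + n) = fun _ => 0 from funext ih] at hd
      have h0 := hd.unique (hasDerivAt_const z (0 : ℂ))
      have hne : a + n ≠ 0 := fun h0 => ha n (eq_neg_of_add_eq_zero_left h0)
      have := (mul_eq_zero.mp h0).resolve_left hne
      push_cast
      rwa [← add_assoc, ← add_assoc]
  obtain ⟨n, hn⟩ := exists_nat_gt (-b.re)
  have h0 := hall n 0
  rw [kummerReg_zero, inv_eq_zero] at h0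
  exact Complex.Gamma_ne_zero_of_re_pos (by simp; linarith) h0

/-! ### The modified Coulomb wave function on the real line -/

/-- Kummer's transformation for the modified Coulomb wave function: it may also be written with
`i` replaced by `-i`. -/
theorem modCoulomb_eq_exp_mul (ℓ η : ℝ) (z : ℂ) :
    modCoulomb ℓ η z = Complex.exp (Complex.I * z) *
      kummerReg ((ℓ : ℂ) + 1 + Complex.I * η) (2 * (ℓ : ℂ) + 2) (-(2 * Complex.I * z)) := by
  have h := exp_neg_mul_kummerReg ((ℓ : ℂ) + 1 - Complex.I * η) (2 * (ℓ : ℂ) + 2)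
    (2 * Complex.I * z)
  rw [show 2 * (ℓ : ℂ) + 2 - ((ℓ : ℂ) + 1 - Complex.I * η) = (ℓ : ℂ) + 1 + Complex.I * η by ring]
    at h
  rw [modCoulomb, ← h, ← mul_assoc, ← Complex.exp_add]
  ring_nf

theorem modCoulomb_neg (ℓ η : ℝ) (z : ℂ) : modCoulomb ℓ η (-z) = modCoulomb ℓ (-η) z := by
  rw [modCoulomb_eq_exp_mul, modCoulomb]
  push_cast
  ring_nf

theorem conj_modCoulomb_ofReal (ℓ η x : ℝ) :
    (starRingEnd ℂ) (modCoulomb ℓ η x) = modCoulomb ℓ η x := by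
  nth_rewrite 2 [modCoulomb_eq_exp_mul]
  rw [modCoulomb, map_mul, conj_kummerReg, ← Complex.exp_conj]
  simp [Complex.conj_ofNat]

/-- The restriction of `modCoulomb ℓ η` to the real line, as a real-valued function. -/
noncomputable def coulombReal (ℓ η x : ℝ) : ℝ := (modCoulomb ℓ η x).re

theorem ofReal_coulombReal (ℓ η x : ℝ) : (coulombReal ℓ η x : ℂ) = modCoulomb ℓ η x :=
  Complex.conj_eq_iff_re.mp (conj_modCoulomb_ofReal ℓ η x)

theorem modCoulomb_ofReal_eq_zero_iff {ℓ η x : ℝ} :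
    modCoulomb ℓ η x = 0 ↔ coulombReal ℓ η x = 0 := by
  rw [← ofReal_coulombReal, Complex.ofReal_eq_zero]

theorem coulombReal_neg (ℓ η x : ℝ) : coulombReal ℓ η (-x) = coulombReal ℓ (-η) x := by
  rw [coulombReal, coulombReal, Complex.ofReal_neg, modCoulomb_neg]

theorem modCoulomb_zero (ℓ η : ℝ) : modCoulomb ℓ η 0 = (Complex.Gamma (2 * (ℓ : ℂ) + 2))⁻¹ := by
  simp [modCoulomb]

theorem coulombReal_zero_eq (ℓ η : ℝ) :
    coulombReal ℓ η 0 = (2 * ℓ + 2) * (2 * ℓ + 3) * coulombReal (ℓ + 1) η 0 := by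
  apply Complex.ofReal_injective
  push_cast
  simp only [ofReal_coulombReal, Complex.ofReal_zero, modCoulomb_zero]
  have h1 := Complex.one_div_Gamma_eq_self_mul_one_div_Gamma_add_one (2 * (ℓ : ℂ) + 2)
  have h2 := Complex.one_div_Gamma_eq_self_mul_one_div_Gamma_add_one (2 * (ℓ : ℂ) + 2 + 1)
  rw [h1, h2]
  push_cast
  rw [show 2 * ((ℓ : ℂ) + 1) + 2 = 2 * ℓ + 2 + 1 + 1 by ring]
  ring

/-! ### The first-order system for consecutive Coulomb functions -/

/-- The product rule for `e^{-iz} K(a, b; 2iz)`; no restriction on `ℓ` is needed here. -/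
theorem hasDerivAt_modCoulomb_aux (ℓ η : ℝ) (z : ℂ) :
    HasDerivAt (modCoulomb ℓ η) (-Complex.I * modCoulomb ℓ η z + Complex.exp (-Complex.I * z) *
      (2 * Complex.I * (((ℓ : ℂ) + 1 - Complex.I * η) *
        kummerReg ((ℓ : ℂ) + 1 - Complex.I * η + 1) (2 * (ℓ : ℂ) + 2 + 1)
          (2 * Complex.I * z)))) z := by
  have h1 : HasDerivAt (fun z : ℂ => Complex.exp (-Complex.I * z))
      (Complex.exp (-Complex.I * z) * -Complex.I) z := by
    simpa using ((hasDerivAt_id z).const_mul (-Complex.I)).cexp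
  have h2 := (hasDerivAt_kummerReg ((ℓ : ℂ) + 1 - Complex.I * η) (2 * (ℓ : ℂ) + 2)
    (2 * Complex.I * z)).comp z ((hasDerivAt_id z).const_mul (2 * Complex.I))
  refine (h1.mul h2).congr_deriv ?_
  simp only [modCoulomb, Function.comp]
  ring

theorem differentiable_modCoulomb (ℓ η : ℝ) : Differentiable ℂ (modCoulomb ℓ η) :=
  fun z => (hasDerivAt_modCoulomb_aux ℓ η z).differentiableAt

theorem hasDerivAt_modCoulomb {ℓ : ℝ} (hℓ : ℓ ≠ -1) (η : ℝ) (z : ℂ) :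
    HasDerivAt (modCoulomb ℓ η) ((η / (ℓ + 1) : ℝ) * modCoulomb ℓ η z +
      (-2 * ((ℓ + 1) ^ 2 + η ^ 2) / (ℓ + 1) : ℝ) * (z * modCoulomb (ℓ + 1) η z)) z := by
  refine (hasDerivAt_modCoulomb_aux ℓ η z).congr_deriv ?_
  have hne : (ℓ : ℂ) + 1 ≠ 0 := fun h => hℓ (by
    have : ((ℓ + 1 : ℝ) : ℂ) = 0 := by exact_mod_cast h
    linarith [Complex.ofReal_eq_zero.mp this])
  have h := mul_kummerReg_add_one ((ℓ : ℂ) + 1 - Complex.I * η) (2 * (ℓ : ℂ) + 2)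
    (2 * Complex.I * z)
  simp only [modCoulomb]
  push_cast
  rw [show (ℓ : ℂ) + 1 + 1 - Complex.I * η = ℓ + 1 - Complex.I * η + 1 by ring,
    show 2 * ((ℓ : ℂ) + 1) + 2 = 2 * ℓ + 2 + 2 by ring]
  have h' : kummerReg ((ℓ : ℂ) + 1 - Complex.I * η + 1) (2 * (ℓ : ℂ) + 2 + 1)
      (2 * Complex.I * z) = (2 * ((ℓ : ℂ) + 1))⁻¹ *
      (kummerReg ((ℓ : ℂ) + 1 - Complex.I * η) (2 * (ℓ : ℂ) + 2) (2 * Complex.I * z) +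
        ((ℓ : ℂ) + 1 + Complex.I * η) * (2 * Complex.I * z *
        kummerReg ((ℓ : ℂ) + 1 - Complex.I * η + 1) (2 * (ℓ : ℂ) + 2 + 2)
          (2 * Complex.I * z))) := by
    rw [eq_inv_mul_iff_mul_eq₀ (mul_ne_zero two_ne_zero hne)]
    linear_combination h
  rw [h']
  generalize kummerReg ((ℓ : ℂ) + 1 - Complex.I * η + 1) (2 * (ℓ : ℂ) + 2 + 2)
    (2 * Complex.I * z) = V
  generalize kummerReg ((ℓ : ℂ) + 1 - Complex.I * η) (2 * (ℓ : ℂ) + 2) (2 * Complex.I * z) = U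
  generalize Complex.exp (-Complex.I * z) = e
  have hI : Complex.I ^ 2 = -1 := Complex.I_sq
  field_simp
  ring_nf
  simp only [show Complex.I ^ 4 = 1 by simp, hI]
  ring

theorem hasDerivAt_modCoulomb_add_one {ℓ : ℝ} (hℓ : ℓ ≠ -1) (η : ℝ) {z : ℂ} (hz : z ≠ 0) :
    HasDerivAt (modCoulomb (ℓ + 1) η) (((2 * (ℓ + 1))⁻¹ * modCoulomb ℓ η z -
      (2 * ℓ + 3 + η / (ℓ + 1) * z) * modCoulomb (ℓ + 1) η z) / z) z := by
  refine (hasDerivAt_modCoulomb_aux (ℓ + 1) η z).congr_deriv ?_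
  have hne : (ℓ : ℂ) + 1 ≠ 0 := fun h => hℓ (by
    have : ((ℓ + 1 : ℝ) : ℂ) = 0 := by exact_mod_cast h
    linarith [Complex.ofReal_eq_zero.mp this])
  have h := mul_kummerReg_add_one ((ℓ : ℂ) + 1 - Complex.I * η) (2 * (ℓ : ℂ) + 2)
    (2 * Complex.I * z)
  have h2 := mul_mul_kummerReg_add_one ((ℓ : ℂ) + 1 - Complex.I * η + 1) (2 * (ℓ : ℂ) + 2 + 2)
    (2 * Complex.I * z)
  rw [show 2 * (ℓ : ℂ) + 2 + 2 - 1 = 2 * ℓ + 2 + 1 by ring] at h2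
  simp only [modCoulomb]
  push_cast
  rw [show (ℓ : ℂ) + 1 + 1 - Complex.I * η = ℓ + 1 - Complex.I * η + 1 by ring,
    show 2 * ((ℓ : ℂ) + 1) + 2 = 2 * ℓ + 2 + 2 by ring, eq_div_iff hz]
  generalize kummerReg ((ℓ : ℂ) + 1 - Complex.I * η + 1 + 1) (2 * (ℓ : ℂ) + 2 + 2 + 1)
    (2 * Complex.I * z) = W at *
  generalize kummerReg ((ℓ : ℂ) + 1 - Complex.I * η + 1) (2 * (ℓ : ℂ) + 2 + 1)
    (2 * Complex.I * z) = S at *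
  generalize kummerReg ((ℓ : ℂ) + 1 - Complex.I * η + 1) (2 * (ℓ : ℂ) + 2 + 2)
    (2 * Complex.I * z) = V at *
  generalize kummerReg ((ℓ : ℂ) + 1 - Complex.I * η) (2 * (ℓ : ℂ) + 2) (2 * Complex.I * z) = U
    at *
  generalize Complex.exp (-Complex.I * z) = e
  have hI : Complex.I ^ 2 = -1 := Complex.I_sq
  field_simp
  linear_combination e * (2 * (ℓ + 1)) * h2 + e * h + 2 * e * V * η * z * hI

theorem hasDerivAt_coulombReal {ℓ : ℝ} (hℓ : ℓ ≠ -1) (η x : ℝ) :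
    HasDerivAt (coulombReal ℓ η) (η / (ℓ + 1) * coulombReal ℓ η x +
      -2 * ((ℓ + 1) ^ 2 + η ^ 2) / (ℓ + 1) * (x * coulombReal (ℓ + 1) η x)) x := by
  refine (hasDerivAt_modCoulomb hℓ η x).real_of_complex.congr_deriv ?_
  rw [← ofReal_coulombReal, ← ofReal_coulombReal, ← Complex.ofReal_mul, ← Complex.ofReal_mul,
    ← Complex.ofReal_mul, ← Complex.ofReal_add, Complex.ofReal_re]

theorem hasDerivAt_coulombReal_add_one {ℓ : ℝ} (hℓ : ℓ ≠ -1) (η : ℝ) {x : ℝ} (hx : x ≠ 0) :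
    HasDerivAt (coulombReal (ℓ + 1) η) (((2 * (ℓ + 1))⁻¹ * coulombReal ℓ η x -
      (2 * ℓ + 3 + η / (ℓ + 1) * x) * coulombReal (ℓ + 1) η x) / x) x := by
  refine (hasDerivAt_modCoulomb_add_one hℓ η
    (Complex.ofReal_ne_zero.mpr hx)).real_of_complex.congr_deriv ?_
  rw [← ofReal_coulombReal, ← ofReal_coulombReal, ← Complex.ofReal_re (_ / x)]
  push_cast
  rfl

theorem continuous_coulombReal (ℓ η : ℝ) : Continuous (coulombReal ℓ η) :=
  Complex.continuous_re.comp
    ((differentiable_modCoulomb ℓ η).continuous.comp Complex.continuous_ofReal)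

/-! ### Discreteness and simplicity of the zeros -/

theorem finite_coulombReal_zeros_Icc (ℓ : ℝ) {η : ℝ} (hη : η ≠ 0) (a b : ℝ) :
    ({x : ℝ | coulombReal ℓ η x = 0} ∩ Set.Icc a b).Finite := by
  by_contra hinf
  obtain ⟨x, -, hx⟩ := Set.Infinite.exists_accPt_of_subset_isCompact hinf isCompact_Icc
    Set.inter_subset_right
  have hfr : ∃ᶠ y : ℝ in 𝓝[≠] x, coulombReal ℓ η y = 0 :=
    (accPt_iff_frequently_nhdsNE.mp hx).mono fun y hy => hy.1
  have hfr' : ∃ᶠ z : ℂ in 𝓝[≠] (x : ℂ), modCoulomb ℓ η z = 0 := by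
    have ht : Tendsto (fun y : ℝ => (y : ℂ)) (𝓝[≠] x) (𝓝[≠] (x : ℂ)) :=
      Complex.continuous_ofReal.continuousAt.tendsto.inf
        (tendsto_principal_principal.mpr fun y hy => by simpa using hy)
    exact ht.frequently (hfr.mono fun y hy => modCoulomb_ofReal_eq_zero_iff.mpr hy)
  have hz := AnalyticOnNhd.eqOn_zero_of_preconnected_of_frequently_eq_zero
    (fun z _ => (differentiable_modCoulomb ℓ η).analyticAt z) isPreconnected_univ
    (Set.mem_univ (x : ℂ)) hfr'
  -- The first parameter is not real, since `η ≠ 0`, so no Pochhammer factor vanishes.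
  obtain ⟨z, hzne⟩ := exists_kummerReg_ne_zero ((ℓ : ℂ) + 1 - Complex.I * η) (2 * (ℓ : ℂ) + 2)
    fun n hn => hη (by simpa using congrArg Complex.im hn)
  have h0 := hz (Set.mem_univ (z / (2 * Complex.I)))
  have hI : (2 * Complex.I) ≠ 0 := mul_ne_zero two_ne_zero Complex.I_ne_zero
  simp only [modCoulomb, mul_div_cancel₀ _ hI, Pi.zero_apply, mul_eq_zero,
    Complex.exp_ne_zero, false_or] at h0
  exact hzne h0

/-- Consecutive Coulomb functions have no common positive zero, by uniqueness for the linear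
system they satisfy. -/
theorem coulombReal_add_one_ne_zero_of_pos {ℓ η x : ℝ} (hℓ : ℓ ≠ -1) (hη : η ≠ 0) (hx : 0 < x)
    (h : coulombReal ℓ η x = 0) : coulombReal (ℓ + 1) η x ≠ 0 := by
  intro h'
  set α := η / (ℓ + 1) with hα
  set d := -2 * ((ℓ + 1) ^ 2 + η ^ 2) / (ℓ + 1) with hd
  set k := (2 * (ℓ + 1))⁻¹ with hk
  set u := coulombReal ℓ η with hu
  set v := coulombReal (ℓ + 1) η with hv
  set K : ℝ := (|α| + |d| * (x + 1)) + (|k| + (|2 * ℓ + 3| + |α| * (x + 1))) / x with hK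
  have hzero : ∀ y ∈ Set.Icc x (x + 1), ‖(u y, v y)‖ ≤ gronwallBound 0 K 0 (y - x) := by
    refine norm_le_gronwallBound_of_norm_deriv_right_le (f' := fun y =>
      (α * u y + d * (y * v y), (k * u y - (2 * ℓ + 3 + α * y) * v y) / y))
      ((continuous_coulombReal ℓ η).prodMk (continuous_coulombReal (ℓ + 1) η)).continuousOn
      (fun y hy => ?_) (by rw [h, h', Prod.mk_zero_zero, norm_zero]) (fun y hy => ?_)
    · have hy0 : y ≠ 0 := (hx.trans_le hy.1).ne'
      exact ((hasDerivAt_coulombReal hℓ η y).prodMk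
        (hasDerivAt_coulombReal_add_one hℓ η hy0)).hasDerivWithinAt
    · have hy0 : 0 < y := hx.trans_le hy.1
      have hu1 : |u y| ≤ ‖(u y, v y)‖ := norm_fst_le (u y, v y)
      have hv1 : |v y| ≤ ‖(u y, v y)‖ := norm_snd_le (u y, v y)
      set E := ‖(u y, v y)‖ with hE
      have hE0 : 0 ≤ E := norm_nonneg _
      have hy1 : |y| ≤ x + 1 := by rw [abs_of_pos hy0]; exact hy.2.le
      have b1 : |α * u y + d * (y * v y)| ≤ (|α| + |d| * (x + 1)) * E := by
        calc |α * u y + d * (y * v y)| ≤ |α| * |u y| + |d| * (|y| * |v y|) := by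
              rw [← abs_mul, ← abs_mul y, ← abs_mul d]; exact abs_add_le _ _
          _ ≤ |α| * E + |d| * ((x + 1) * E) := by gcongr
          _ = _ := by ring
      have b2 : |(k * u y - (2 * ℓ + 3 + α * y) * v y) / y| ≤
          (|k| + (|2 * ℓ + 3| + |α| * (x + 1))) / x * E := by
        have b3 : |2 * ℓ + 3 + α * y| ≤ |2 * ℓ + 3| + |α| * (x + 1) := by
          refine (abs_add_le _ _).trans ?_
          rw [abs_mul]
          gcongr
        have b4 : |k * u y - (2 * ℓ + 3 + α * y) * v y| ≤
            (|k| + (|2 * ℓ + 3| + |α| * (x + 1))) * E := by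
          calc |k * u y - (2 * ℓ + 3 + α * y) * v y|
              ≤ |k| * |u y| + |2 * ℓ + 3 + α * y| * |v y| := by
                rw [← abs_mul, ← abs_mul (2 * ℓ + 3 + α * y)]; exact abs_sub _ _
            _ ≤ |k| * E + (|2 * ℓ + 3| + |α| * (x + 1)) * E := by gcongr
            _ = _ := by ring
        rw [abs_div, abs_of_pos hy0]
        exact (div_le_div₀ (by positivity) b4 hx hy.1).trans_eq (mul_div_right_comm _ _ _)
      have p1 : 0 ≤ (|α| + |d| * (x + 1)) * E := by positivity
      have p2 : 0 ≤ (|k| + (|2 * ℓ + 3| + |α| * (x + 1))) / x * E := by positivity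
      rw [add_zero, hK, Prod.norm_mk, Real.norm_eq_abs, Real.norm_eq_abs]
      exact max_le (by linarith) (by linarith)
  have hsub : Set.Icc x (x + 1) ⊆ {y : ℝ | coulombReal ℓ η y = 0} ∩ Set.Icc x (x + 1) := by
    refine fun y hy => ⟨?_, hy⟩
    have h0 := hzero y hy
    rw [gronwallBound_ε0_δ0] at h0
    exact norm_le_zero_iff.mp ((norm_fst_le (u y, v y)).trans h0)
  exact Set.Icc_infinite (by linarith) ((finite_coulombReal_zeros_Icc ℓ hη x (x + 1)).subset hsub)

theorem coulombReal_add_one_ne_zero {ℓ η x : ℝ} (hℓ : ℓ ≠ -1) (hη : η ≠ 0) (hx : x ≠ 0)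
    (h : coulombReal ℓ η x = 0) : coulombReal (ℓ + 1) η x ≠ 0 := by
  rcases hx.lt_or_gt with hx | hx
  · have := coulombReal_add_one_ne_zero_of_pos (x := -x) hℓ (neg_ne_zero.mpr hη) (neg_pos.mpr hx)
      (by rwa [← coulombReal_neg, neg_neg])
    rwa [← coulombReal_neg, neg_neg] at this
  · exact coulombReal_add_one_ne_zero_of_pos hℓ hη hx h

theorem analyticOrderAt_modCoulomb_eq_one {ℓ η x : ℝ} (hℓ : ℓ ≠ -1) (hη : η ≠ 0) (hx : x ≠ 0)
    (h : modCoulomb ℓ η x = 0) : analyticOrderAt (modCoulomb ℓ η) (x : ℂ) = 1 := by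
  have hv := coulombReal_add_one_ne_zero hℓ hη hx (modCoulomb_ofReal_eq_zero_iff.mp h)
  refine ((differentiable_modCoulomb ℓ η).analyticAt _).analyticOrderAt_eq_one_of_zero_deriv_ne_zero
    h ?_
  have hℓ' : ℓ + 1 ≠ 0 := fun h0 => hℓ (by linarith)
  rw [(hasDerivAt_modCoulomb hℓ η x).deriv, h, mul_zero, zero_add]
  refine mul_ne_zero ?_ (mul_ne_zero (Complex.ofReal_ne_zero.mpr hx)
    fun h0 => hv (modCoulomb_ofReal_eq_zero_iff.mp h0))
  have : 0 < (ℓ + 1) ^ 2 + η ^ 2 := by positivity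
  exact Complex.ofReal_ne_zero.mpr (div_ne_zero (by linarith) hℓ')

/-! ### Oscillation -/

/-- Sturm comparison of `w'' = -q w`, `q ≥ 1 / 4`, with `sin ((x - X) / 2)` over half a period of the
latter. -/
theorem exists_zero_of_quarter_le {w w' q : ℝ → ℝ} {X : ℝ}
    (hw : ∀ x ∈ Set.Icc X (X + 2 * Real.pi), HasDerivAt w (w' x) x)
    (hw' : ∀ x ∈ Set.Icc X (X + 2 * Real.pi), HasDerivAt w' (-(q x * w x)) x)
    (hq : ∀ x ∈ Set.Icc X (X + 2 * Real.pi), 1 / 4 ≤ q x) :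
    ∃ x ∈ Set.Icc X (X + 2 * Real.pi), w x = 0 := by
  have hpi := Real.pi_pos
  by_contra! hne
  wlog hX : 0 < w X generalizing w w'
  · refine this (w := fun x => -w x) (w' := fun x => -w' x) (fun x hx => (hw x hx).neg)
      (fun x hx => (hw' x hx).neg.congr_deriv (by ring)) (fun x hx => neg_ne_zero.mpr (hne x hx)) ?_
    have := hne X ⟨le_rfl, by linarith⟩
    rcases this.lt_or_gt with h | h
    · exact neg_pos.mpr h
    · exact absurd h hX
  have hcont : ContinuousOn w (Set.Icc X (X + 2 * Real.pi)) := fun x hx =>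
    (hw x hx).continuousAt.continuousWithinAt
  have hpos : ∀ x ∈ Set.Icc X (X + 2 * Real.pi), 0 < w x := by
    intro x hx
    by_contra! hle
    obtain ⟨y, hy, hy0⟩ := intermediate_value_Icc' hx.1
      (hcont.mono (Set.Icc_subset_Icc_right hx.2)) ⟨hle, hX.le⟩
    exact hne y ⟨hy.1, hy.2.trans hx.2⟩ hy0
  set F : ℝ → ℝ := fun x => w' x * Real.sin ((x - X) / 2) - w x * (Real.cos ((x - X) / 2) / 2)
    with hF
  have hFd : ∀ x ∈ Set.Icc X (X + 2 * Real.pi),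
      HasDerivAt F (-((q x - 1 / 4) * w x * Real.sin ((x - X) / 2))) x := by
    intro x hx
    have hl : HasDerivAt (fun x : ℝ => (x - X) / 2) (1 / 2) x :=
      ((hasDerivAt_id x).sub_const X).div_const 2
    refine (((hw' x hx).mul hl.sin).sub ((hw x hx).mul (hl.cos.div_const 2))).congr_deriv ?_
    ring
  have hanti : AntitoneOn F (Set.Icc X (X + 2 * Real.pi)) := by
    refine antitoneOn_of_hasDerivWithinAt_nonpos (convex_Icc _ _)
      (fun x hx => (hFd x hx).continuousAt.continuousWithinAt)
      (fun x hx => (hFd x (interior_subset hx)).hasDerivWithinAt) fun x hx => ?_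
    have hx' := interior_subset hx
    have h1 := hq x hx'
    have h2 := (hpos x hx').le
    have h3 : 0 ≤ Real.sin ((x - X) / 2) :=
      Real.sin_nonneg_of_nonneg_of_le_pi (by linarith [hx'.1]) (by linarith [hx'.2])
    have : 0 ≤ (q x - 1 / 4) * w x * Real.sin ((x - X) / 2) :=
      mul_nonneg (mul_nonneg (by linarith) h2) h3
    linarith
  have hl : X ∈ Set.Icc X (X + 2 * Real.pi) := ⟨le_rfl, by linarith⟩
  have hr : X + 2 * Real.pi ∈ Set.Icc X (X + 2 * Real.pi) := ⟨by linarith, le_rfl⟩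
  have h := hanti hl hr (by linarith)
  have hs : (X + 2 * Real.pi - X) / 2 = Real.pi := by ring
  simp only [hF, hs, sub_self, zero_div, Real.sin_pi, Real.cos_pi, Real.sin_zero,
    Real.cos_zero] at h
  linarith [hpos _ hr]

/-- `w = x ^ (ℓ + 1) φ` satisfies the Coulomb equation `w'' + (1 - 2η/x - ℓ(ℓ + 1)/x²) w = 0`, whose
potential tends to `1`, so its solutions oscillate. -/
theorem exists_gt_coulombReal_eq_zero {ℓ : ℝ} (hℓ : ℓ ≠ -1) (η X : ℝ) :
    ∃ x, X < x ∧ coulombReal ℓ η x = 0 := by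
  have hℓ' : ℓ + 1 ≠ 0 := fun h0 => hℓ (by linarith)
  set Y : ℝ := |X| + 1 + 4 * (2 * |η| + |ℓ * (ℓ + 1)|) with hY
  have hY1 : 1 ≤ Y := by rw [hY]; linarith [abs_nonneg X, abs_nonneg η, abs_nonneg (ℓ * (ℓ + 1))]
  have hXY : X < Y := by
    rw [hY]; linarith [le_abs_self X, abs_nonneg η, abs_nonneg (ℓ * (ℓ + 1))]
  suffices h : ∃ x ∈ Set.Icc Y (Y + 2 * Real.pi), x ^ (ℓ + 1) * coulombReal ℓ η x = 0 by
    obtain ⟨x, hx, hx0⟩ := h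
    refine ⟨x, hXY.trans_le hx.1, (mul_eq_zero.mp hx0).resolve_left ?_⟩
    exact (Real.rpow_pos_of_pos (by linarith [hx.1]) _).ne'
  refine exists_zero_of_quarter_le (X := Y)
    (w := fun x => x ^ (ℓ + 1) * coulombReal ℓ η x)
    (w' := fun x => x ^ (ℓ + 1) * ((η / (ℓ + 1) + (ℓ + 1) / x) * coulombReal ℓ η x +
      -2 * ((ℓ + 1) ^ 2 + η ^ 2) / (ℓ + 1) * (x * coulombReal (ℓ + 1) η x)))
    (q := fun x => 1 - 2 * η / x - ℓ * (ℓ + 1) / x ^ 2)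
    (fun x hx => ?_) (fun x hx => ?_) (fun x hx => ?_)
  · have hx0 : 0 < x := by linarith [hx.1]
    have hp := Real.hasDerivAt_rpow_const (x := x) (p := ℓ + 1) (Or.inl hx0.ne')
    rw [Real.rpow_sub_one hx0.ne'] at hp
    refine (hp.mul (hasDerivAt_coulombReal hℓ η x)).congr_deriv ?_
    field_simp
    ring
  · have hx0 : 0 < x := by linarith [hx.1]
    have hp := Real.hasDerivAt_rpow_const (x := x) (p := ℓ + 1) (Or.inl hx0.ne')
    rw [Real.rpow_sub_one hx0.ne'] at hp
    have hi : HasDerivAt (fun x : ℝ => η / (ℓ + 1) + (ℓ + 1) / x) (-(ℓ + 1) / x ^ 2) x := by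
      have := ((hasDerivAt_inv hx0.ne').const_mul (ℓ + 1)).const_add (η / (ℓ + 1))
      refine this.congr_deriv ?_
      ring
    have hv := ((hasDerivAt_id x).mul (hasDerivAt_coulombReal_add_one hℓ η hx0.ne')).const_mul
      (-2 * ((ℓ + 1) ^ 2 + η ^ 2) / (ℓ + 1))
    refine (hp.mul ((hi.mul (hasDerivAt_coulombReal hℓ η x)).add hv)).congr_deriv ?_
    simp only [id, Pi.mul_apply, Pi.add_apply]
    field_simp
    ring
  · have hx0 : 0 < x := by linarith [hx.1]
    have hx1 : 1 ≤ x := hY1.trans hx.1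
    have h1 : 2 * η / x + ℓ * (ℓ + 1) / x ^ 2 ≤ 1 / 4 := by
      have e : 2 * η / x + ℓ * (ℓ + 1) / x ^ 2 = (2 * η + ℓ * (ℓ + 1) / x) / x := by
        field_simp
      rw [e, div_le_iff₀ hx0]
      have h2 : ℓ * (ℓ + 1) / x ≤ |ℓ * (ℓ + 1)| := by
        rw [div_le_iff₀ hx0]
        nlinarith [le_abs_self (ℓ * (ℓ + 1)), abs_nonneg (ℓ * (ℓ + 1))]
      have h3 := hx.1
      rw [hY] at h3
      linarith [le_abs_self η, abs_nonneg X]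
    linarith

/-! ### Interlacing -/

theorem exists_coulombReal_add_one_eq_zero_between {ℓ η r s : ℝ} (hℓ : ℓ ≠ -1) (hη : η ≠ 0)
    (hr : 0 < r) (hrs : r < s) (hr0 : coulombReal ℓ η r = 0) (hs0 : coulombReal ℓ η s = 0) :
    ∃ y, r < y ∧ y < s ∧ coulombReal (ℓ + 1) η y = 0 := by
  have hℓ' : ℓ + 1 ≠ 0 := fun h0 => hℓ (by linarith)
  have hd : ∀ x, HasDerivAt (fun x => Real.exp (-(η / (ℓ + 1)) * x) * coulombReal ℓ η x)
      (Real.exp (-(η / (ℓ + 1)) * x) * (-2 * ((ℓ + 1) ^ 2 + η ^ 2) / (ℓ + 1) *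
        (x * coulombReal (ℓ + 1) η x))) x := by
    intro x
    have he := ((hasDerivAt_id x).const_mul (-(η / (ℓ + 1)))).exp
    refine (he.mul (hasDerivAt_coulombReal hℓ η x)).congr_deriv ?_
    simp only [id]
    ring
  -- The exponential is an integrating factor for the first equation of the system.
  obtain ⟨y, hy, hy0⟩ := exists_hasDerivAt_eq_zero hrs
    (fun x _ => (hd x).continuousAt.continuousWithinAt) (by simp [hr0, hs0]) fun x _ => hd x
  have hc : -2 * ((ℓ + 1) ^ 2 + η ^ 2) / (ℓ + 1) ≠ 0 := by
    have : 0 < (ℓ + 1) ^ 2 + η ^ 2 := by positivity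
    exact div_ne_zero (by linarith) hℓ'
  refine ⟨y, hy.1, hy.2, ?_⟩
  have h := (mul_eq_zero.mp hy0).resolve_left (Real.exp_ne_zero _)
  exact (mul_eq_zero.mp ((mul_eq_zero.mp h).resolve_left hc)).resolve_left (hr.trans hy.1).ne'

theorem exists_coulombReal_eq_zero_between {ℓ η r s : ℝ} (hℓ : ℓ ≠ -1)
    (hr : 0 < r) (hrs : r < s) (hr0 : coulombReal (ℓ + 1) η r = 0)
    (hs0 : coulombReal (ℓ + 1) η s = 0) :
    ∃ y, r < y ∧ y < s ∧ coulombReal ℓ η y = 0 := by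
  have hℓ' : ℓ + 1 ≠ 0 := fun h0 => hℓ (by linarith)
  have hd : ∀ x, 0 < x → HasDerivAt (fun x => x ^ (2 * ℓ + 3) * (Real.exp (η / (ℓ + 1) * x) *
      coulombReal (ℓ + 1) η x)) (x ^ (2 * ℓ + 3) * (Real.exp (η / (ℓ + 1) * x) *
        ((2 * (ℓ + 1))⁻¹ * coulombReal ℓ η x / x))) x := by
    intro x hx
    have he := ((hasDerivAt_id x).const_mul (η / (ℓ + 1))).exp
    have hp := Real.hasDerivAt_rpow_const (x := x) (p := 2 * ℓ + 3) (Or.inl hx.ne')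
    rw [Real.rpow_sub_one hx.ne'] at hp
    refine (hp.mul (he.mul (hasDerivAt_coulombReal_add_one hℓ η hx.ne'))).congr_deriv ?_
    simp only [id, Pi.mul_apply]
    field_simp
    ring
  obtain ⟨y, hy, hy0⟩ := exists_hasDerivAt_eq_zero hrs
    (fun x hx => (hd x (hr.trans_le hx.1)).continuousAt.continuousWithinAt) (by simp [hr0, hs0])
    fun x hx => hd x (hr.trans hx.1)
  have hy1 : 0 < y := hr.trans hy.1
  have hp : y ^ (2 * ℓ + 3) ≠ 0 := (Real.rpow_pos_of_pos hy1 _).ne'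
  refine ⟨y, hy.1, hy.2, ?_⟩
  simpa [Real.exp_ne_zero, hp, hℓ', hy1.ne'] using hy0

/-- Before the first positive zero of the function of order `ℓ ≤ -3/2` there is one of the function
of order `ℓ + 1`. Up to the first zero of the latter, `e^{-ηx/(ℓ+1)} φ_ℓ` moves away from `0`, as the
values of the two functions at the origin do not have opposite signs. -/
theorem exists_coulombReal_add_one_eq_zero_lt {ℓ η r : ℝ} (hℓ : ℓ ≤ -3 / 2)
    (hr : 0 < r) (hr0 : coulombReal ℓ η r = 0) :
    ∃ y, 0 < y ∧ y < r ∧ coulombReal (ℓ + 1) η y = 0 := by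
  have hℓ1 : ℓ ≠ -1 := fun h => by linarith
  set d := -2 * ((ℓ + 1) ^ 2 + η ^ 2) / (ℓ + 1) with hd
  have hd0 : 0 < d := by
    have : 0 < (ℓ + 1) ^ 2 := by nlinarith
    exact div_pos_of_neg_of_neg (by nlinarith [sq_nonneg η]) (by linarith)
  have hder : ∀ x, HasDerivAt (fun x => Real.exp (-(η / (ℓ + 1)) * x) * coulombReal ℓ η x)
      (Real.exp (-(η / (ℓ + 1)) * x) * (d * (x * coulombReal (ℓ + 1) η x))) x := by
    intro x
    have he := ((hasDerivAt_id x).const_mul (-(η / (ℓ + 1)))).exp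
    refine (he.mul (hasDerivAt_coulombReal hℓ1 η x)).congr_deriv ?_
    simp only [id]
    ring
  obtain ⟨c, ⟨hc0, hcr⟩, hc⟩ := exists_hasDerivAt_eq_slope _ _ hr
    (fun x _ => (hder x).continuousAt.continuousWithinAt) fun x _ => hder x
  by_cases hv : coulombReal (ℓ + 1) η c = 0
  · exact ⟨c, hc0, hcr, hv⟩
  rw [eq_div_iff (by linarith)] at hc
  simp only [hr0, mul_zero, Real.exp_zero, one_mul, sub_zero, zero_sub] at hc
  rw [coulombReal_zero_eq] at hc
  set v0 := coulombReal (ℓ + 1) η 0 with hv0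
  set vc := coulombReal (ℓ + 1) η c with hvc
  have hP : 0 ≤ (2 * ℓ + 2) * (2 * ℓ + 3) := by nlinarith
  -- If `v c ≠ 0`, then by the mean value identity `hc` the sign of `v` changes between `0` and `c`.
  have hneg : v0 * vc < 0 := by
    have h1 : 0 < Real.exp (-(η / (ℓ + 1)) * c) * (d * c) * r := by positivity
    have h2 : 0 < vc * vc := mul_self_pos.mpr hv
    have h3 : (2 * ℓ + 2) * (2 * ℓ + 3) * (v0 * vc) < 0 := by
      have := mul_pos h1 h2
      have e : (2 * ℓ + 2) * (2 * ℓ + 3) * (v0 * vc) =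
        -(Real.exp (-(η / (ℓ + 1)) * c) * (d * c) * r * (vc * vc)) := by
        linear_combination vc * hc
      linarith
    by_contra! h4
    linarith [mul_nonneg hP h4]
  have hcont := (continuous_coulombReal (ℓ + 1) η).continuousOn (s := Set.Icc 0 c)
  have : ∃ y ∈ Set.Ioo 0 c, coulombReal (ℓ + 1) η y = 0 := by
    rcases mul_neg_iff.mp hneg with ⟨h1, h2⟩ | ⟨h1, h2⟩
    · exact intermediate_value_Ioo' hc0.le hcont ⟨h2, h1⟩
    · exact intermediate_value_Ioo hc0.le hcont ⟨h1, h2⟩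
  obtain ⟨y, hy, hy0⟩ := this
  exact ⟨y, hy.1, hy.2.trans hcr, hy0⟩

/-! ### Enumeration of the zeros -/

/-- A locally finite set of reals, bounded below and unbounded above, is order isomorphic to `ℕ`. -/
theorem exists_strictMono_range_eq {Z : Set ℝ} (hfin : ∀ a b, (Z ∩ Set.Icc a b).Finite)
    (hbdd : BddBelow Z) (hunb : ∀ X, ∃ x ∈ Z, X < x) :
    ∃ ρ : ℕ → ℝ, StrictMono ρ ∧ Set.range ρ = Z := by
  obtain ⟨x₀, hx₀, -⟩ := hunb 0
  obtain ⟨B, hB⟩ := hbdd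
  obtain ⟨m, ⟨hmZ, -⟩, hm⟩ := Set.exists_min_image _ id (hfin B x₀) ⟨x₀, hx₀, hB hx₀, le_rfl⟩
  have hmin : ∀ x ∈ Z, m ≤ x := by
    intro x hx
    rcases le_total x x₀ with h | h
    · exact hm x ⟨hx, hB hx, h⟩
    · exact (hm x₀ ⟨hx₀, hB hx₀, le_rfl⟩).trans h
  let : LocallyFiniteOrder Z := LocallyFiniteOrder.ofFiniteIcc fun a b =>
    Set.Finite.of_finite_image ((hfin a b).subset (by
      rintro _ ⟨x, hx, rfl⟩
      exact ⟨x.2, hx⟩)) Subtype.val_injective.injOn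
  let : OrderBot Z := { bot := ⟨m, hmZ⟩, bot_le := fun x => hmin x x.2 }
  have : NoMaxOrder Z := ⟨fun x => by
    obtain ⟨y, hy, hxy⟩ := hunb x
    exact ⟨⟨y, hy⟩, hxy⟩⟩
  let : SuccOrder Z := LinearLocallyFiniteOrder.succOrder Z
  let : PredOrder Z := LinearLocallyFiniteOrder.predOrder Z
  let e : Z ≃o ℕ := orderIsoNatOfLinearSuccPredArch
  refine ⟨fun n => e.symm n, fun i j hij => e.symm.strictMono hij, ?_⟩
  ext x
  constructor
  · rintro ⟨n, rfl⟩
    exact (e.symm n).2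
  · exact fun hx => ⟨e ⟨x, hx⟩, by simp⟩

theorem interlace_of_exists_between {ρ σ : ℕ → ℝ} (hρ : StrictMono ρ) (hσ : StrictMono σ)
    (h0 : ∃ j, σ j < ρ 0)
    (hρσ : ∀ k, ∃ j, ρ k < σ j ∧ σ j < ρ (k + 1))
    (hσρ : ∀ k, ∃ j, σ k < ρ j ∧ ρ j < σ (k + 1)) (k : ℕ) :
    σ k < ρ k ∧ ρ k < σ (k + 1) := by
  induction k with
  | zero =>
    obtain ⟨j, hj⟩ := h0
    refine ⟨(hσ.monotone j.zero_le).trans_lt hj, ?_⟩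
    obtain ⟨i, hi, hi'⟩ := hσρ 0
    exact (hρ.monotone i.zero_le).trans_lt hi'
  | succ k ih =>
    have h1 : σ (k + 1) < ρ (k + 1) := by
      obtain ⟨j, hj, hj'⟩ := hρσ k
      have : k + 1 ≤ j := hσ.lt_iff_lt.mp (ih.1.trans hj)
      exact (hσ.monotone this).trans_lt hj'
    refine ⟨h1, ?_⟩
    obtain ⟨j, hj, hj'⟩ := hσρ (k + 1)
    have : k + 1 ≤ j := hρ.lt_iff_lt.mp (ih.2.trans hj)
    exact (hρ.monotone this).trans_lt hj'

/-- The positive half-line for all `η ≠ 0`; replacing `η` by `-η` gives the negative one. -/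
theorem exists_interlacing_positiveZeroSeq {ℓ η : ℝ} (hℓ : ℓ ≤ -3 / 2) (hη : η ≠ 0) :
    ∃ ρ σ : ℕ → ℝ,
      IsPositiveZeroSeq (modCoulomb ℓ η) ρ ∧ IsPositiveZeroSeq (modCoulomb (ℓ + 1) η) σ ∧
      ∀ k : ℕ, σ k < ρ k ∧ ρ k < σ (k + 1) := by
  have hℓ1 : ℓ ≠ -1 := fun h => by linarith
  have hfin : ∀ ℓ' a b : ℝ,
      ({x : ℝ | 0 < x ∧ modCoulomb ℓ' η x = 0} ∩ Set.Icc a b).Finite := fun ℓ' a b =>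
    (finite_coulombReal_zeros_Icc ℓ' hη a b).subset fun x hx =>
      ⟨modCoulomb_ofReal_eq_zero_iff.mp hx.1.2, hx.2⟩
  have hbdd : ∀ ℓ' : ℝ, BddBelow {x : ℝ | 0 < x ∧ modCoulomb ℓ' η x = 0} := fun ℓ' =>
    ⟨0, fun x hx => hx.1.le⟩
  have hunb : ∀ X : ℝ, ∃ x ∈ {x : ℝ | 0 < x ∧ modCoulomb ℓ η x = 0}, X < x := by
    intro X
    obtain ⟨x, hx, hx0⟩ := exists_gt_coulombReal_eq_zero hℓ1 η (max X 0)
    exact ⟨x, ⟨(le_max_right _ _).trans_lt hx, modCoulomb_ofReal_eq_zero_iff.mpr hx0⟩,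
      (le_max_left _ _).trans_lt hx⟩
  have hbetween : ∀ r s : ℝ, 0 < r → r < s → modCoulomb ℓ η r = 0 → modCoulomb ℓ η s = 0 →
      ∃ y ∈ {x : ℝ | 0 < x ∧ modCoulomb (ℓ + 1) η x = 0}, r < y ∧ y < s := by
    intro r s hr hrs hr0 hs0
    obtain ⟨y, hy, hy', hy0⟩ := exists_coulombReal_add_one_eq_zero_between hℓ1 hη hr hrs
      (modCoulomb_ofReal_eq_zero_iff.mp hr0) (modCoulomb_ofReal_eq_zero_iff.mp hs0)
    exact ⟨y, ⟨hr.trans hy, modCoulomb_ofReal_eq_zero_iff.mpr hy0⟩, hy, hy'⟩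
  have hunb' : ∀ X : ℝ, ∃ x ∈ {x : ℝ | 0 < x ∧ modCoulomb (ℓ + 1) η x = 0}, X < x := by
    intro X
    obtain ⟨r, hr, hXr⟩ := hunb X
    obtain ⟨s, hs, hrs⟩ := hunb r
    obtain ⟨y, hy, hry, -⟩ := hbetween r s hr.1 hrs hr.2 hs.2
    exact ⟨y, hy, hXr.trans hry⟩
  obtain ⟨ρ, hρ, hρZ⟩ := exists_strictMono_range_eq (hfin ℓ) (hbdd ℓ) hunb
  obtain ⟨σ, hσ, hσZ⟩ := exists_strictMono_range_eq (hfin (ℓ + 1)) (hbdd (ℓ + 1)) hunb'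
  have hρm : ∀ k, 0 < ρ k ∧ modCoulomb ℓ η (ρ k) = 0 := fun k => hρZ.subset ⟨k, rfl⟩
  have hσm : ∀ k, 0 < σ k ∧ modCoulomb (ℓ + 1) η (σ k) = 0 := fun k => hσZ.subset ⟨k, rfl⟩
  refine ⟨ρ, σ, ⟨hρ, hρZ⟩, ⟨hσ, hσZ⟩, interlace_of_exists_between hρ hσ ?_ ?_ ?_⟩
  · obtain ⟨y, hy, hy', hy0⟩ := exists_coulombReal_add_one_eq_zero_lt hℓ (hρm 0).1
      (modCoulomb_ofReal_eq_zero_iff.mp (hρm 0).2)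
    obtain ⟨j, rfl⟩ := hσZ.superset ⟨hy, modCoulomb_ofReal_eq_zero_iff.mpr hy0⟩
    exact ⟨j, hy'⟩
  · intro k
    obtain ⟨y, hyZ, hy⟩ := hbetween (ρ k) (ρ (k + 1)) (hρm k).1 (hρ k.lt_succ_self) (hρm k).2
      (hρm (k + 1)).2
    obtain ⟨j, rfl⟩ := hσZ.superset hyZ
    exact ⟨j, hy⟩
  · intro k
    obtain ⟨y, hy, hy', hy0⟩ := exists_coulombReal_eq_zero_between hℓ1 (hσm k).1
      (hσ k.lt_succ_self) (modCoulomb_ofReal_eq_zero_iff.mp (hσm k).2)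
      (modCoulomb_ofReal_eq_zero_iff.mp (hσm (k + 1)).2)
    obtain ⟨j, rfl⟩ := hρZ.superset ⟨(hσm k).1.trans hy, modCoulomb_ofReal_eq_zero_iff.mpr hy0⟩
    exact ⟨j, hy, hy'⟩

theorem IsPositiveZeroSeq.neg {ℓ η : ℝ} {ρ : ℕ → ℝ} (h : IsPositiveZeroSeq (modCoulomb ℓ (-η)) ρ) :
    IsNegativeZeroSeq (modCoulomb ℓ η) (fun k => -ρ k) := by
  refine ⟨fun i j hij => neg_lt_neg (h.1 hij), ?_⟩
  ext x
  have hx := Set.ext_iff.mp h.2 (-x)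
  simp only [Set.mem_range, Set.mem_ofPred_eq, Complex.ofReal_neg, modCoulomb_neg, neg_neg,
    neg_pos] at hx ⊢
  rw [← hx]
  simp only [neg_eq_iff_eq_neg]

theorem theorem3p2 (ℓ η : ℝ) (hℓ : ℓ ≤ -3 / 2) (hη : η ≠ 0) :
    -- countably infinitely many real zeros
    {x : ℝ | modCoulomb ℓ η x = 0}.Infinite ∧ {x : ℝ | modCoulomb ℓ η x = 0}.Countable ∧
    -- every real zero other than the origin is simple
    (∀ x : ℝ, x ≠ 0 → modCoulomb ℓ η x = 0 → analyticOrderAt (modCoulomb ℓ η) (x : ℂ) = 1) ∧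
    -- the origin is a zero only if `2ℓ` is an integer
    (modCoulomb ℓ η 0 = 0 → ∃ m : ℤ, 2 * ℓ = m) ∧
    -- interlacing on the positive half-line
    (∃ ρ σ : ℕ → ℝ,
      IsPositiveZeroSeq (modCoulomb ℓ η) ρ ∧ IsPositiveZeroSeq (modCoulomb (ℓ + 1) η) σ ∧
      ∀ k : ℕ, σ k < ρ k ∧ ρ k < σ (k + 1)) ∧
    -- interlacing on the negative half-line
    (∃ ρ σ : ℕ → ℝ,
      IsNegativeZeroSeq (modCoulomb ℓ η) ρ ∧ IsNegativeZeroSeq (modCoulomb (ℓ + 1) η) σ ∧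
      ∀ k : ℕ, ρ k < σ k ∧ σ (k + 1) < ρ k) := by
  have hℓ1 : ℓ ≠ -1 := fun h => by linarith
  obtain ⟨ρ, σ, hρ, hσ, hint⟩ := exists_interlacing_positiveZeroSeq hℓ hη
  obtain ⟨ν, τ, hν, hτ, hint'⟩ := exists_interlacing_positiveZeroSeq hℓ (neg_ne_zero.mpr hη)
  refine ⟨?_, ?_, fun x hx h => analyticOrderAt_modCoulomb_eq_one hℓ1 hη hx h, fun h => ?_,
    ⟨ρ, σ, hρ, hσ, hint⟩, ⟨fun k => -ν k, fun k => -τ k, hν.neg, hτ.neg, fun k => ?_⟩⟩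
  · refine (Set.infinite_range_of_injective hρ.1.injective).mono ?_
    rw [hρ.2]
    exact fun x hx => hx.2
  · refine (((Set.countable_range ρ).union (Set.countable_range fun k => -ν k)).union
      (Set.countable_singleton 0)).mono fun x hx => ?_
    rw [hρ.2, hν.neg.2]
    rcases lt_trichotomy x 0 with h | h | h
    · exact Or.inl (Or.inr ⟨h, hx⟩)
    · exact Or.inr h
    · exact Or.inl (Or.inl ⟨h, hx⟩)
  · rw [modCoulomb_zero, inv_eq_zero, Complex.Gamma_eq_zero_iff] at h
    obtain ⟨m, hm⟩ := h
    have hm' : 2 * ℓ + 2 = -(m : ℝ) := by exact_mod_cast hm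
    refine ⟨-m - 2, ?_⟩
    push_cast
    linarith
  · exact ⟨neg_lt_neg (hint' k).1, neg_lt_neg (hint' k).2⟩
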